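/- Let $(\mathsf{E},\mathscr{E})$ be a measurable space, $\mu$ a probability measure on it, and $T$ a Markov kernel on $(\mathsf{E},\mathscr{E})$ which is $\mu$-invariant ($\mu T=\mu$) and $\mu$-irreducible, i.e. for every $A\in\mathscr{E}$ with $\mu(A)>0$ and every $x\in\mathsf{E}$, $\sum_{n=0}^{\infty}\lambda^{n}T^{n}(x,A)>0$ for some (equivalently, all) $\lambda\in(0,1)$; equivalently, $T^n(x,A)>0$ for some $n\geq 0$. Let $\mathrm{L}^2_0(\mu)$ be the set of $f\in \mathrm{L}^2(\mu)$ (real-valued) with $\mu(f)=0$; for $f\in\mathrm{L}^2(\mu)$ let $\mathcal{E}(T,f)=\langle(\mathrm{Id}-T)f,f\rangle_{\mathrm{L}^2(\mu)}$ and $\|f\|_{\mathrm{osc}}=\operatorname{ess\,sup}_\mu f-\operatorname{ess\,inf}_\mu f\in[0,\infty]$; and let $\mathfrak{a}=\sup\{\|f\|_2^2/\|f\|_{\mathrm{osc}}^2 : f\in\mathrm{L}^2_0(\mu)\setminus\{0\}\}$ (with $\sup\emptyset=0$), which is finite. Then $T$ satisfies a $\|\cdot\|_{\mathrm{osc}}^2$-weak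 Poincaré inequality, in each of its three (equivalent) parametrizations: 1. there is a decreasing (i.e. non-increasing) function $\alpha:(0,\infty)\to[0,\infty)$ such that $$\|f\|_2^2\le \alpha(r)\,\mathcal{E}(T,f)+r\,\|f\|_{\mathrm{osc}}^2\qquad\text{for all } r>0,\ f\in\mathrm{L}^2_0(\mu);$$ 2. there is a decreasing (i.e. non-increasing) function $\beta:(0,\infty)\to[0,\infty)$ with $\beta(s)\to0$ as $s\to\infty$ such that $$\|f\|_2^2\le s\,\mathcal{E}(T,f)+\beta(s)\,\|f\|_{\mathrm{osc}}^2\qquad\text{for all } s>0,\ f\in\mathrm{L}^2_0(\mu);$$ 3. there is a nonnegative, convex, strictly increasing function $K^*:[0,\mathfrak{a}]\to[0,\infty)$ with $K^*(0)=0$ such that $$\frac{\mathcal{E}(T,f)}{\|f\|_{\mathrm{osc}}^2}\ge K^*\!\left(\frac{\|f\|_2^2}{\|f\|_{\mathrm{osc}}^2}\right)\qquad\text{for all } f\in\mathrm{L}^2_0(\mu)\text{ with } 0<\|f\|_{\mathrm{osc}}<\infty.$$ -/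

import Mathlib

open MeasureTheory ProbabilityTheory Filter Topology
open scoped ENNReal

namespace WeakPoincare

noncomputable section

/-- `Kernel.IsIrreducible` is irreducibility in the resolvent form: for every (equivalently, some)
`lam ∈ (0,1)`, `∑ₙ lamⁿ Tⁿ(x, A) > 0` for all `x` and all measurable `A` with `ν A > 0`. -/
theorem isIrreducible_iff_resolvent {E : Type*} [MeasurableSpace E] (ν : Measure E)
    (T : Kernel E E) (lam : ℝ≥0∞) (h0 : 0 < lam) :
    Kernel.IsIrreducible ν T ↔
      ∀ A : Set E, MeasurableSet A → 0 < ν A →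
        ∀ x : E, 0 < ∑' n : ℕ, lam ^ n * (T ^ n) x A := by
  rw [Kernel.isIrreducible_iff]
  refine forall_congr' fun A => forall_congr' fun _ => forall_congr' fun _ =>
    forall_congr' fun x => ?_
  rw [pos_iff_ne_zero, Ne, ENNReal.tsum_eq_zero]
  simp [pos_iff_ne_zero, h0.ne']

/-- The centred subspace `L²₀(μ)` of the real Hilbert space `L²(μ)`, as a set. -/
def L2Zero {E : Type*} [MeasurableSpace E] (μ : Measure E) : Set (Lp ℝ 2 μ) :=
  {f | ∫ x, f x ∂μ = 0}

/-- The action of a kernel on functions, `(T f)(x) = ∫ f(y) T(x, dy)`. -/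
def kernelAct {E : Type*} [MeasurableSpace E] (T : Kernel E E) (f : E → ℝ) (x : E) : ℝ :=
  ∫ y, f y ∂(T x)

/-- The Dirichlet form `ℰ(T, f) = ⟨(Id - T) f, f⟩` in `L²(μ)`. If `T` is a `μ`-invariant Markov
kernel, `T f` is in `L²(μ)` and its class does not depend on the representative of `f`. -/
def dirichletForm {E : Type*} [MeasurableSpace E] (μ : Measure E) (T : Kernel E E)
    (f : Lp ℝ 2 μ) : ℝ :=
  ∫ x, (f x - kernelAct T f x) * f x ∂μ

/-- The oscillation `ess sup f - ess inf f`; it is `∞` if `f` is not essentially bounded.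
The essential bounds are taken in `[-∞, ∞]`, where they always exist. -/
def oscNorm {E : Type*} [MeasurableSpace E] (μ : Measure E) (f : E → ℝ) : ℝ≥0∞ :=
  (essSup (fun x => (f x : EReal)) μ - essInf (fun x => (f x : EReal)) μ).toENNReal

/-- The functional `Ψ(f) = ‖f‖_osc²` on `L²(μ)`, with values in `[0, ∞]`. -/
def oscSq {E : Type*} [MeasurableSpace E] (μ : Measure E) (f : Lp ℝ 2 μ) : ℝ≥0∞ :=
  oscNorm μ f ^ 2

/-- `𝔞 = sup {‖f‖₂² / Ψ(f) : f ∈ L²₀(μ), f ≠ 0}`. -/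
def sieveConst {E : Type*} [MeasurableSpace E] (μ : Measure E)
    (Ψ : Lp ℝ 2 μ → ℝ≥0∞) : ℝ≥0∞ :=
  ⨆ f ∈ L2Zero μ \ {0}, ENNReal.ofReal (‖f‖ ^ 2) / Ψ f

/-- The `(Ψ, α)`-weak Poincaré inequality, for a decreasing `α : (0, ∞) → [0, ∞)`. -/
structure IsAlphaWPI {E : Type*} [MeasurableSpace E] (μ : Measure E) (T : Kernel E E)
    (Ψ : Lp ℝ 2 μ → ℝ≥0∞) (α : ℝ → ℝ) : Prop where
  nonneg : ∀ r, 0 < r → 0 ≤ α r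
  antitone : AntitoneOn α (Set.Ioi 0)
  ineq : ∀ r, 0 < r → ∀ f ∈ L2Zero μ,
    ENNReal.ofReal (‖f‖ ^ 2) ≤
      ENNReal.ofReal (α r * dirichletForm μ T f) + ENNReal.ofReal r * Ψ f

/-- The `(Ψ, β)`-weak Poincaré inequality, for a decreasing `β : (0, ∞) → [0, ∞)` that tends
to `0` at infinity. -/
structure IsBetaWPI {E : Type*} [MeasurableSpace E] (μ : Measure E) (T : Kernel E E)
    (Ψ : Lp ℝ 2 μ → ℝ≥0∞) (β : ℝ → ℝ) : Prop where
  nonneg : ∀ s, 0 < s → 0 ≤ β s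
  antitone : AntitoneOn β (Set.Ioi 0)
  tendsto : Tendsto β atTop (𝓝 0)
  ineq : ∀ s, 0 < s → ∀ f ∈ L2Zero μ,
    ENNReal.ofReal (‖f‖ ^ 2) ≤
      ENNReal.ofReal (s * dirichletForm μ T f) + ENNReal.ofReal (β s) * Ψ f

/-- The `(Ψ, K*)`-weak Poincaré inequality, for a nonnegative, convex, strictly increasing
`K*` on `[0, 𝔞]` with `K*(0) = 0`. The endpoint `𝔞` is included since the quotient
`‖f‖₂² / Ψ(f)` may attain it. -/
structure IsKStarWPI {E : Type*} [MeasurableSpace E] (μ : Measure E) (T : Kernel E E)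
    (Ψ : Lp ℝ 2 μ → ℝ≥0∞) (K : ℝ → ℝ) : Prop where
  sieveConst_lt_top : sieveConst μ Ψ < ⊤
  nonneg : ∀ v ∈ Set.Icc 0 (sieveConst μ Ψ).toReal, 0 ≤ K v
  convex : ConvexOn ℝ (Set.Icc 0 (sieveConst μ Ψ).toReal) K
  strictMono : StrictMonoOn K (Set.Icc 0 (sieveConst μ Ψ).toReal)
  map_zero : K 0 = 0
  ineq : ∀ f ∈ L2Zero μ, 0 < Ψ f → Ψ f < ⊤ →
    K (‖f‖ ^ 2 / (Ψ f).toReal) ≤ dirichletForm μ T f / (Ψ f).toReal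

/-- `T` satisfies a `Ψ`-weak Poincaré inequality, in each of the three parametrizations. -/
structure SatisfiesWPI {E : Type*} [MeasurableSpace E] (μ : Measure E) (T : Kernel E E)
    (Ψ : Lp ℝ 2 μ → ℝ≥0∞) : Prop where
  alpha : ∃ α : ℝ → ℝ, IsAlphaWPI μ T Ψ α
  beta : ∃ β : ℝ → ℝ, IsBetaWPI μ T Ψ β
  kStar : ∃ K : ℝ → ℝ, IsKStarWPI μ T Ψ K

end

end WeakPoincare

namespace WeakPoincare

variable {E : Type*} [MeasurableSpace E] {μ : Measure E} {T : Kernel E E}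

/-! ### The oscillation -/

/-! It is enough to bound `‖f‖²` by `s ℰ(T, f) + r ‖f‖_osc²` for each `r > 0` and some `s`
(`exists_mem_admissible`), and this is a compactness-type argument by contradiction
(`exists_energy_bound`). Otherwise there are centred `g k`, bounded by 1, with summable jump
energies but `∫ (g k)²` bounded below. Summability gives `g k x - g k y → 0` along almost every step
of the stationary chain. This relation in `(x, y)` is transitive, so invariance carries it to `T ^
n` and irreducibility to almost all pairs. Centring then forces `g k → 0` almost everywhere,
contradicting the lower bound.

The functions `α` and `β` are optimal constants plus a slack, and `K*` is a supremum of truncated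
affine functions built from `β`. -/

lemma exists_bounds_of_oscNorm_lt_top [IsProbabilityMeasure μ] {f : E → ℝ}
    (hf : oscNorm μ f < ⊤) :
    ∃ a b : ℝ, (∀ᵐ x ∂μ, a ≤ f x ∧ f x ≤ b) ∧ oscNorm μ f = ENNReal.ofReal (b - a) := by
  unfold oscNorm at *
  have hle : ∀ᵐ x ∂μ, (f x : EReal) ≤ essSup (fun x => (f x : EReal)) μ := ae_le_essSup
  have hge : ∀ᵐ x ∂μ, essInf (fun x => (f x : EReal)) μ ≤ (f x : EReal) := ae_essInf_le
  generalize essSup (fun x => (f x : EReal)) μ = S at *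
  generalize essInf (fun x => (f x : EReal)) μ = I at *
  obtain ⟨x, hx1, hx2⟩ := (hle.and hge).exists
  have hS : S ≠ ⊥ := fun h => by simp [h] at hx1
  have hI : I ≠ ⊤ := fun h => by simp [h] at hx2
  have hSI : S - I ≠ ⊤ := fun h => by simp [h] at hf
  have hI' : I ≠ ⊥ := fun h => hSI (by rw [h, EReal.sub_bot hS])
  have hS' : S ≠ ⊤ := fun h => hSI (by rw [h, EReal.top_sub hI])
  lift S to ℝ using ⟨hS', hS⟩
  lift I to ℝ using ⟨hI, hI'⟩
  refine ⟨I, S, ?_, ?_⟩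
  · filter_upwards [hle, hge] with x h1 h2
    exact ⟨by exact_mod_cast h2, by exact_mod_cast h1⟩
  · rw [← EReal.coe_sub, EReal.real_coe_toENNReal]

lemma abs_le_of_integral_eq_zero [IsProbabilityMeasure μ] {f : E → ℝ} (hfi : Integrable f μ)
    (h0 : ∫ x, f x ∂μ = 0) {a b : ℝ} (hab : ∀ᵐ x ∂μ, a ≤ f x ∧ f x ≤ b) :
    a ≤ b ∧ ∀ᵐ x ∂μ, |f x| ≤ b - a := by
  have ha : a ≤ 0 := by
    have := integral_mono_ae (integrable_const a) hfi (hab.mono fun x hx => hx.1)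
    simpa [h0] using this
  have hb : 0 ≤ b := by
    have := integral_mono_ae hfi (integrable_const b) (hab.mono fun x hx => hx.2)
    simpa [h0] using this
  refine ⟨ha.trans hb, hab.mono fun x hx => abs_le.2 ⟨by linarith [hx.1], by linarith [hx.2]⟩⟩

/-- A centred function of finite oscillation is bounded by its oscillation. -/
lemma exists_osc_bound [IsProbabilityMeasure μ] {f : Lp ℝ 2 μ} (h0 : f ∈ L2Zero μ)
    (hf : oscSq μ f < ⊤) :
    ∃ o : ℝ, 0 ≤ o ∧ (∀ᵐ x ∂μ, |f x| ≤ o) ∧ oscSq μ f = ENNReal.ofReal (o ^ 2) := by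
  have hf' : oscNorm μ f < ⊤ := by
    rw [oscSq] at hf
    exact lt_top_iff_ne_top.2 fun h => by simp [h] at hf
  obtain ⟨a, b, hab, ho⟩ := exists_bounds_of_oscNorm_lt_top hf'
  obtain ⟨h1, h2⟩ := abs_le_of_integral_eq_zero
    ((Lp.memLp f).integrable (by norm_num)) h0 hab
  exact ⟨b - a, by linarith, h2, by
    rw [oscSq, ho, ENNReal.ofReal_pow (by linarith)]⟩

lemma norm_sq_eq_integral (f : Lp ℝ 2 μ) : ‖f‖ ^ 2 = ∫ x, f x ^ 2 ∂μ := by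
  rw [← real_inner_self_eq_norm_sq, L2.inner_def]
  simp [sq]

lemma integral_sq_le [IsProbabilityMeasure μ] {f : E → ℝ} {o : ℝ}
    (hf : ∀ᵐ x ∂μ, |f x| ≤ o) : ∫ x, f x ^ 2 ∂μ ≤ o ^ 2 := by
  have := integral_mono_of_nonneg (μ := μ) (f := fun x => f x ^ 2) (g := fun _ => o ^ 2)
    (ae_of_all _ fun x => sq_nonneg _) (integrable_const _)
    (hf.mono fun x hx => sq_le_sq' (abs_le.1 hx).1 (abs_le.1 hx).2)
  simpa using this

lemma ofReal_norm_sq_le_oscSq [IsProbabilityMeasure μ] {f : Lp ℝ 2 μ} (h0 : f ∈ L2Zero μ) :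
    ENNReal.ofReal (‖f‖ ^ 2) ≤ oscSq μ f := by
  rcases eq_or_ne (oscSq μ f) ⊤ with h | h
  · simp [h]
  obtain ⟨o, -, hb, ho⟩ := exists_osc_bound h0 (lt_top_iff_ne_top.2 h)
  rw [ho, norm_sq_eq_integral]
  exact ENNReal.ofReal_le_ofReal (integral_sq_le hb)

lemma sieveConst_oscSq_le_one [IsProbabilityMeasure μ] : sieveConst μ (oscSq μ) ≤ 1 := by
  refine iSup₂_le fun f hf => ENNReal.div_le_of_le_mul ?_
  rw [one_mul]
  exact ofReal_norm_sq_le_oscSq hf.1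

/-! ### The jump form of the Dirichlet form -/

lemma integral_comp_of_measurePreserving {α β : Type*} [MeasurableSpace α] [MeasurableSpace β]
    {m : Measure α} {ν : Measure β} {φ : α → β} (hφ : MeasurePreserving φ m ν) {g : β → ℝ}
    (hg : AEStronglyMeasurable g ν) : ∫ x, g (φ x) ∂m = ∫ y, g y ∂ν := by
  rw [← hφ.map_eq] at hg ⊢
  exact (integral_map hφ.aemeasurable hg).symm

/-- Both marginals of `μ ⊗ₘ T` are `μ` by invariance, so expanding the square suffices;
reversibility plays no role. -/
lemma dirichletForm_eq [IsProbabilityMeasure μ] [IsMarkovKernel T] (hinv : Kernel.Invariant T μ)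
    (f : Lp ℝ 2 μ) :
    dirichletForm μ T f = 2⁻¹ * ∫ p, (f p.1 - f p.2) ^ 2 ∂(μ ⊗ₘ T) := by
  have hf := Lp.memLp f
  have h1 : MeasurePreserving Prod.fst (μ ⊗ₘ T) μ :=
    ⟨measurable_fst, Measure.fst_compProd μ T⟩
  have h2 : MeasurePreserving Prod.snd (μ ⊗ₘ T) μ :=
    ⟨measurable_snd, (Measure.snd_compProd μ T).trans hinv⟩
  have hf1 : MemLp (fun p : E × E => f p.1) 2 (μ ⊗ₘ T) := hf.comp_measurePreserving h1
  have hf2 : MemLp (fun p : E × E => f p.2) 2 (μ ⊗ₘ T) := hf.comp_measurePreserving h2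
  have hm : Integrable (fun p : E × E => f p.1 * f p.2) (μ ⊗ₘ T) := hf1.integrable_mul hf2
  have hs : AEStronglyMeasurable (fun x => f x ^ 2) μ := hf.1.pow 2
  have e1 : ∫ p : E × E, f p.1 ^ 2 ∂(μ ⊗ₘ T) = ∫ x, f x ^ 2 ∂μ := by
    exact integral_comp_of_measurePreserving h1 hs
  have e2 : ∫ p : E × E, f p.2 ^ 2 ∂(μ ⊗ₘ T) = ∫ x, f x ^ 2 ∂μ := by
    exact integral_comp_of_measurePreserving h2 hs
  have e3 : ∫ p : E × E, f p.1 * f p.2 ∂(μ ⊗ₘ T) = ∫ x, f x * kernelAct T f x ∂μ := by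
    rw [Measure.integral_compProd hm]
    simp_rw [integral_const_mul, kernelAct]
  have i3 : Integrable (fun x => f x * kernelAct T f x) μ := by
    have : Integrable (fun x => ∫ y, f x * f y ∂T x) μ := hm.integral_compProd
    simpa only [integral_const_mul, kernelAct] using this
  have e4 : dirichletForm μ T f = ∫ x, f x ^ 2 ∂μ - ∫ x, f x * kernelAct T f x ∂μ := by
    rw [dirichletForm, ← integral_sub hf.integrable_sq i3]
    congr 1; ext x; ring
  have e5 : ∫ p, (f p.1 - f p.2) ^ 2 ∂(μ ⊗ₘ T) =
      ∫ p : E × E, f p.1 ^ 2 ∂(μ ⊗ₘ T) + ∫ p : E × E, f p.2 ^ 2 ∂(μ ⊗ₘ T)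
        - 2 * ∫ p : E × E, f p.1 * f p.2 ∂(μ ⊗ₘ T) := by
    rw [← integral_const_mul, ← integral_add hf1.integrable_sq hf2.integrable_sq,
      ← integral_sub (f := fun p : E × E => f p.1 ^ 2 + f p.2 ^ 2)
        (hf1.integrable_sq.add hf2.integrable_sq) (hm.const_mul 2)]
    congr 1; ext p; ring
  rw [e5, e1, e2, e3, e4]; ring

lemma dirichletForm_nonneg [IsProbabilityMeasure μ] [IsMarkovKernel T]
    (hinv : Kernel.Invariant T μ) (f : Lp ℝ 2 μ) : 0 ≤ dirichletForm μ T f := by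
  rw [dirichletForm_eq hinv]
  exact mul_nonneg (by norm_num) (integral_nonneg fun p => sq_nonneg _)

/-! ### Irreducibility and sequences of vanishing energy -/

/-- A transitive relation that holds along almost every step of a stationary chain holds between
the starting point and the position after any number of steps. -/
lemma ae_ae_pow_of_ae_ae (hinv : Kernel.Invariant T μ) {R : E → E → Prop}
    (hR : MeasurableSet {p : E × E | R p.1 p.2}) (hrefl : ∀ x, R x x)
    (htrans : ∀ x y z, R x y → R y z → R x z)
    (h : ∀ᵐ x ∂μ, ∀ᵐ y ∂T x, R x y) (n : ℕ) :
    ∀ᵐ x ∂μ, ∀ᵐ y ∂(T ^ n) x, R x y := by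
  have hRx : ∀ x, MeasurableSet {y | R x y} := fun x => measurable_prodMk_left hR
  induction n with
  | zero =>
    refine ae_of_all _ fun x => ?_
    rw [pow_zero, show (1 : Kernel E E) = Kernel.id from rfl, Kernel.id_apply,
      ae_dirac_iff (hRx x)]
    exact hrefl x
  | succ n ih =>
    -- Since `μ T = μ`, a property of `μ`-almost every point also holds after one step from almost
    -- every `x`.
    have ih' : ∀ᵐ x ∂μ, ∀ᵐ y ∂T x, ∀ᵐ z ∂(T ^ n) y, R y z := by
      refine Measure.ae_ae_of_ae_comp ?_
      rwa [hinv.def]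
    filter_upwards [h, ih'] with x h1 h2
    rw [Kernel.pow_add, pow_one, Kernel.comp_apply,
      Measure.ae_comp_iff (hRx x)]
    filter_upwards [h1, h2] with y h3 h4
    filter_upwards [h4] with z h5
    exact htrans x y z h3 h5

lemma ae_ae_of_isIrreducible (hinv : Kernel.Invariant T μ) (hirr : Kernel.IsIrreducible μ T)
    {R : E → E → Prop} (hR : MeasurableSet {p : E × E | R p.1 p.2}) (hrefl : ∀ x, R x x)
    (htrans : ∀ x y z, R x y → R y z → R x z) (h : ∀ᵐ x ∂μ, ∀ᵐ y ∂T x, R x y) :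
    ∀ᵐ x ∂μ, ∀ᵐ y ∂μ, R x y := by
  have hall := ae_all_iff.2 fun n => ae_ae_pow_of_ae_ae hinv hR hrefl htrans h n
  filter_upwards [hall] with x hx
  have hA : MeasurableSet {y | ¬ R x y} := (measurable_prodMk_left (x := x) hR).compl
  -- Were the set of `y` failing `R x y` of positive measure, some `T ^ n` would charge it from `x`.
  by_contra hne
  obtain ⟨n, hn⟩ := (Kernel.isIrreducible_iff _ _).1 hirr hA (pos_iff_ne_zero.2 hne) x
  exact hn.ne' (hx n)

/-- The sum of the squares has finite integral, hence is finite almost everywhere. No subsequence is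
needed. -/
lemma ae_tendsto_zero_of_tsum_lintegral {α : Type*} [MeasurableSpace α] {m : Measure α}
    {u : ℕ → α → ℝ} (hu : ∀ k, Measurable (u k)) (hi : ∀ k, Integrable (fun x => u k x ^ 2) m)
    {c : ℕ → ℝ} (hc : Summable c) (h : ∀ k, ∫ x, u k x ^ 2 ∂m ≤ c k) :
    ∀ᵐ x ∂m, Tendsto (fun k => u k x) atTop (𝓝 0) := by
  have hfin : ∫⁻ x, ∑' k, ENNReal.ofReal (u k x ^ 2) ∂m ≠ ⊤ := by
    rw [lintegral_tsum fun k => ((hu k).pow_const 2).ennreal_ofReal.aemeasurable]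
    refine ne_top_of_le_ne_top hc.tsum_ofReal_ne_top (ENNReal.tsum_le_tsum fun k => ?_)
    rw [← ofReal_integral_eq_lintegral_ofReal (hi k) (ae_of_all _ fun x => sq_nonneg _)]
    exact ENNReal.ofReal_le_ofReal (h k)
  filter_upwards [ae_lt_top (by fun_prop) hfin] with x hx
  have h1 := (ENNReal.tendsto_toReal (by simp)).comp
    (ENNReal.tendsto_atTop_zero_of_tsum_ne_top hx.ne)
  have h2 : Tendsto (fun k => u k x ^ 2) atTop (𝓝 0) := by
    simpa [Function.comp_def, ENNReal.toReal_ofReal, sq_nonneg] using h1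
  have h3 := h2.sqrt
  simp only [Real.sqrt_sq_eq_abs, Real.sqrt_zero] at h3
  exact (tendsto_zero_iff_abs_tendsto_zero _).2 h3

lemma tendsto_integral_sq_zero [IsProbabilityMeasure μ] {g : ℕ → E → ℝ}
    (hg : ∀ k, Measurable (g k)) (hb : ∀ k, ∀ᵐ x ∂μ, |g k x| ≤ 1) (h0 : ∀ k, ∫ x, g k x ∂μ = 0)
    (h : ∀ᵐ x ∂μ, ∀ᵐ y ∂μ, Tendsto (fun k => g k x - g k y) atTop (𝓝 0)) :
    Tendsto (fun k => ∫ x, g k x ^ 2 ∂μ) atTop (𝓝 0) := by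
  have hb' := ae_all_iff.2 hb
  have hi : ∀ k, Integrable (g k) μ := fun k =>
    .of_bound (hg k).aestronglyMeasurable 1 (by simpa using hb k)
  obtain ⟨x, hx, hx1⟩ := (h.and hb').exists
  -- Integrating `g k x - g k y` over `y` leaves `g k x`, because `g k` is centred.
  have hc : Tendsto (fun k => g k x) atTop (𝓝 0) := by
    have := tendsto_integral_of_dominated_convergence (μ := μ)
      (F := fun k y => g k x - g k y) (f := fun _ => 0) (fun _ => 2)
      (fun k => (measurable_const.sub (hg k)).aestronglyMeasurable) (integrable_const _)
      (fun k => by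
        filter_upwards [hb k] with y hy
        rw [Real.norm_eq_abs]
        linarith [abs_sub (g k x) (g k y), hx1 k]) hx
    simpa [integral_sub (integrable_const _) (hi _), h0] using this
  have := tendsto_integral_of_dominated_convergence (μ := μ)
      (F := fun k y => g k y ^ 2) (f := fun _ => 0) (fun _ => 1)
      (fun k => ((hg k).pow_const 2).aestronglyMeasurable) (integrable_const _)
      (fun k => by
        filter_upwards [hb k] with y hy
        simpa using hy)
      (by
        filter_upwards [hx] with y hy
        simpa using (hc.sub hy).pow 2)
  simpa using this

lemma exists_energy_bound [IsProbabilityMeasure μ] [IsMarkovKernel T]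
    (hinv : Kernel.Invariant T μ) (hirr : Kernel.IsIrreducible μ T) {ε : ℝ} (hε : 0 < ε) :
    ∃ δ > 0, ∀ g : E → ℝ, Measurable g → (∀ᵐ x ∂μ, |g x| ≤ 1) → ∫ x, g x ∂μ = 0 →
      ∫ p, (g p.1 - g p.2) ^ 2 ∂(μ ⊗ₘ T) ≤ δ → ∫ x, g x ^ 2 ∂μ ≤ ε := by
  by_contra! hcon
  choose g hg hb h0 he hgt using fun k : ℕ => hcon ((1 / 2 : ℝ) ^ k) (by positivity)
  have h1 : MeasurePreserving Prod.fst (μ ⊗ₘ T) μ :=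
    ⟨measurable_fst, Measure.fst_compProd μ T⟩
  have h2 : MeasurePreserving Prod.snd (μ ⊗ₘ T) μ :=
    ⟨measurable_snd, (Measure.snd_compProd μ T).trans hinv⟩
  have hmem : ∀ k, MemLp (g k) 2 μ := fun k =>
    .of_bound (hg k).aestronglyMeasurable 1 (by simpa using hb k)
  have hint : ∀ k, Integrable (fun p : E × E => (g k p.1 - g k p.2) ^ 2) (μ ⊗ₘ T) := fun k =>
    (((hmem k).comp_measurePreserving h1).sub
      ((hmem k).comp_measurePreserving h2)).integrable_sq
  have hmeas : ∀ k, Measurable (fun p : E × E => g k p.1 - g k p.2) := fun k =>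
    ((hg k).comp measurable_fst).sub ((hg k).comp measurable_snd)
  have hae := ae_tendsto_zero_of_tsum_lintegral hmeas hint summable_geometric_two he
  have := ae_ae_of_isIrreducible hinv hirr
    (R := fun x y => Tendsto (fun k => g k x - g k y) atTop (𝓝 0))
    (measurableSet_tendsto (𝓝 0) hmeas) (fun x => by simp)
    (fun x y z hxy hyz => by simpa using hxy.add hyz)
    (Measure.ae_ae_of_ae_compProd hae)
  have hlim := tendsto_integral_sq_zero hg hb h0 this
  exact absurd (ge_of_tendsto' hlim fun k => (hgt k).le) (not_le.2 hε)

/-! ### The weak Poincaré inequalities -/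

/-- The set of `r ≥ 0` with `‖f‖² ≤ s ℰ(T, f) + r Ψ(f)` for all centred `f` with `Ψ(f) < ∞`. -/
def admissible (μ : Measure E) (T : Kernel E E) (Ψ : Lp ℝ 2 μ → ℝ≥0∞) (s : ℝ) : Set ℝ :=
  {r | 0 ≤ r ∧ ∀ f ∈ L2Zero μ, Ψ f < ⊤ →
    ‖f‖ ^ 2 ≤ s * dirichletForm μ T f + r * (Ψ f).toReal}

lemma exists_mem_admissible [IsProbabilityMeasure μ] [IsMarkovKernel T]
    (hinv : Kernel.Invariant T μ) (hirr : Kernel.IsIrreducible μ T) {r : ℝ} (hr : 0 < r) :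
    ∃ s, 0 ≤ s ∧ r ∈ admissible μ T (oscSq μ) s := by
  obtain ⟨δ, hδ, H⟩ := exists_energy_bound hinv hirr hr
  -- If `2 ℰ ≥ δ o²`, the energy term alone dominates `o² ≥ ‖f‖²`; otherwise the energy bound
  -- applies to `f / o`.
  refine ⟨2 / δ, by positivity, hr.le, fun f h0 hf => ?_⟩
  obtain ⟨o, ho0, hb, ho⟩ := exists_osc_bound h0 hf
  have hE := dirichletForm_nonneg hinv f
  have hle := integral_sq_le hb
  rw [← norm_sq_eq_integral] at hle
  rw [ho, ENNReal.toReal_ofReal (sq_nonneg o)]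
  rcases ho0.eq_or_lt with rfl | hop
  · have : 0 ≤ 2 / δ * dirichletForm μ T f := by positivity
    nlinarith
  rcases le_total (δ * o ^ 2) (2 * dirichletForm μ T f) with hc | hc
  · have : o ^ 2 ≤ 2 / δ * dirichletForm μ T f := by
      rw [div_mul_eq_mul_div, le_div_iff₀ hδ]; linarith
    nlinarith [sq_nonneg o]
  have hen : ∫ p, (f p.1 - f p.2) ^ 2 ∂(μ ⊗ₘ T) = 2 * dirichletForm μ T f := by
    rw [dirichletForm_eq hinv]; ring
  have key := H (fun x => f x / o) ((Lp.stronglyMeasurable f).measurable.div_const o)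
    (hb.mono fun x hx => by rw [abs_div, abs_of_pos hop]; exact (div_le_one hop).2 hx)
    (by rw [integral_div, show ∫ x, f x ∂μ = 0 from h0, zero_div])
    (by
      simp_rw [← sub_div, div_pow]
      rw [integral_div, hen, div_le_iff₀ (by positivity)]
      exact hc)
  simp_rw [div_pow] at key
  rw [integral_div, ← norm_sq_eq_integral, div_le_iff₀ (by positivity)] at key
  have : 0 ≤ 2 / δ * dirichletForm μ T f := by positivity
  linarith

lemma one_mem_admissible [IsProbabilityMeasure μ] [IsMarkovKernel T]
    (hinv : Kernel.Invariant T μ) {s : ℝ} (hs : 0 ≤ s) : 1 ∈ admissible μ T (oscSq μ) s := by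
  refine ⟨zero_le_one, fun f h0 hf => ?_⟩
  have h1 := (ENNReal.ofReal_le_iff_le_toReal hf.ne).1 (ofReal_norm_sq_le_oscSq h0)
  have := mul_nonneg hs (dirichletForm_nonneg hinv f)
  linarith

lemma admissible_mono [IsProbabilityMeasure μ] [IsMarkovKernel T]
    (hinv : Kernel.Invariant T μ) {Ψ : Lp ℝ 2 μ → ℝ≥0∞} {s t : ℝ} (hst : s ≤ t) :
    admissible μ T Ψ s ⊆ admissible μ T Ψ t := fun _ hr =>
  ⟨hr.1, fun f h0 hf => (hr.2 f h0 hf).trans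
    (add_le_add_left (mul_le_mul_of_nonneg_right hst (dirichletForm_nonneg hinv f)) _)⟩

lemma admissible_of_le {Ψ : Lp ℝ 2 μ → ℝ≥0∞} {s r r' : ℝ} (hr : r ∈ admissible μ T Ψ s)
    (h : r ≤ r') : r' ∈ admissible μ T Ψ s :=
  ⟨hr.1.trans h, fun f h0 hf => (hr.2 f h0 hf).trans
    (add_le_add_right (mul_le_mul_of_nonneg_right h ENNReal.toReal_nonneg) _)⟩

/-- Strict positivity of `r` covers `Ψ f = ⊤`, since `0 * ⊤ = 0` in `ℝ≥0∞`. -/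
lemma ofReal_norm_sq_le_of_mem_admissible [IsProbabilityMeasure μ] [IsMarkovKernel T]
    (hinv : Kernel.Invariant T μ) {Ψ : Lp ℝ 2 μ → ℝ≥0∞} {s r : ℝ} (hs : 0 ≤ s) (hr0 : 0 < r)
    (hr : r ∈ admissible μ T Ψ s) {f : Lp ℝ 2 μ} (hf : f ∈ L2Zero μ) :
    ENNReal.ofReal (‖f‖ ^ 2) ≤
      ENNReal.ofReal (s * dirichletForm μ T f) + ENNReal.ofReal r * Ψ f := by
  rcases eq_or_ne (Ψ f) ⊤ with h | h
  · simp [h, ENNReal.mul_top, hr0]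
  rw [← ENNReal.ofReal_toReal h, ← ENNReal.ofReal_mul hr0.le,
    ← ENNReal.ofReal_add (mul_nonneg hs (dirichletForm_nonneg hinv f)) (by positivity)]
  exact ENNReal.ofReal_le_ofReal (hr.2 f hf (lt_top_iff_ne_top.2 h))

lemma exists_isAlphaWPI [IsProbabilityMeasure μ] [IsMarkovKernel T]
    (hinv : Kernel.Invariant T μ) {Ψ : Lp ℝ 2 μ → ℝ≥0∞}
    (H : ∀ r > 0, ∃ s, 0 ≤ s ∧ r ∈ admissible μ T Ψ s) :
    ∃ α : ℝ → ℝ, IsAlphaWPI μ T Ψ α := by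
  have hbdd : ∀ r, BddBelow {s | 0 ≤ s ∧ r ∈ admissible μ T Ψ s} := fun r =>
    ⟨0, fun s hs => hs.1⟩
  have h0 : ∀ r, 0 ≤ sInf {s | 0 ≤ s ∧ r ∈ admissible μ T Ψ s} := fun r =>
    Real.sInf_nonneg fun s hs => hs.1
  -- The slack `1` avoids checking that the infimum is attained.
  refine ⟨fun r => sInf {s | 0 ≤ s ∧ r ∈ admissible μ T Ψ s} + 1, fun r _ => ?_, ?_, ?_⟩
  · linarith [h0 r]
  · intro r hr r' _ hrr'
    exact add_le_add_left (csInf_le_csInf (hbdd r') (H r hr)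
      fun s hs => ⟨hs.1, admissible_of_le hs.2 hrr'⟩) 1
  · intro r hr f hf
    obtain ⟨s, hs, hlt⟩ := exists_lt_of_csInf_lt (H r hr) (lt_add_one _)
    exact ofReal_norm_sq_le_of_mem_admissible hinv (add_nonneg (h0 r) zero_le_one) hr
      (admissible_mono hinv hlt.le hs.2) hf

lemma exists_isBetaWPI [IsProbabilityMeasure μ] [IsMarkovKernel T]
    (hinv : Kernel.Invariant T μ) {Ψ : Lp ℝ 2 μ → ℝ≥0∞}
    (H : ∀ r > 0, ∃ s, 0 ≤ s ∧ r ∈ admissible μ T Ψ s)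
    (hne : ∀ s > 0, (admissible μ T Ψ s).Nonempty) :
    ∃ β : ℝ → ℝ, IsBetaWPI μ T Ψ β := by
  have hbdd : ∀ s, BddBelow (admissible μ T Ψ s) := fun s => ⟨0, fun _ hr => hr.1⟩
  have h0 : ∀ s, 0 ≤ sInf (admissible μ T Ψ s) := fun s => Real.sInf_nonneg fun r hr => hr.1
  -- The slack `s⁻¹` is decreasing, vanishes at infinity and keeps `β s` positive.
  refine ⟨fun s => sInf (admissible μ T Ψ s) + s⁻¹, fun s hs => ?_, ?_, ?_, ?_⟩
  · have := h0 s
    positivity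
  · intro s hs t _ hst
    exact add_le_add (csInf_le_csInf (hbdd t) (hne s hs) (admissible_mono hinv hst))
      (inv_anti₀ hs hst)
  · have : Tendsto (fun s => sInf (admissible μ T Ψ s)) atTop (𝓝 0) := by
      rw [Metric.tendsto_atTop]
      intro ε hε
      obtain ⟨s, hs, hr⟩ := H (ε / 2) (by positivity)
      refine ⟨s, fun t ht => ?_⟩
      rw [Real.dist_eq, sub_zero, abs_of_nonneg (h0 t)]
      linarith [csInf_le (hbdd t) (admissible_mono hinv ht hr)]
    simpa using this.add tendsto_inv_atTop_zero
  · intro s hs f hf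
    have hs' : 0 < s⁻¹ := inv_pos.2 hs
    obtain ⟨r, hr, hlt⟩ := exists_lt_of_csInf_lt (hne s hs) (lt_add_of_pos_right _ hs')
    exact ofReal_norm_sq_le_of_mem_admissible hinv (le_of_lt hs) (by linarith [h0 s])
      (admissible_of_le hr hlt.le) hf

/-- Convexity between `0` and `v` gives `K u ≤ (u / v) K v < K v` for `0 < u < v`. -/
lemma strictMonoOn_of_convexOn {K : ℝ → ℝ} {S : Set ℝ} (hS : 0 ∈ S) (hS0 : ∀ v ∈ S, 0 ≤ v)
    (hK : ConvexOn ℝ S K) (h0 : K 0 = 0) (hpos : ∀ v, 0 < v → 0 < K v) : StrictMonoOn K S := by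
  intro u hu v hv huv
  rcases (hS0 u hu).eq_or_lt with rfl | hu0
  · rw [h0]; exact hpos v huv
  have hv0 : 0 < v := hu0.trans huv
  have h1 : u / v < 1 := (div_lt_one hv0).2 huv
  have := hK.2 hS hv (show 0 ≤ 1 - u / v by linarith)
    (show 0 ≤ u / v by positivity) (by ring)
  simp only [smul_eq_mul, mul_zero, zero_add, h0, div_mul_cancel₀ _ hv0.ne'] at this
  nlinarith [hpos v hv0]

lemma IsBetaWPI.exists_isKStarWPI [IsProbabilityMeasure μ] [IsMarkovKernel T]
    (hinv : Kernel.Invariant T μ) {Ψ : Lp ℝ 2 μ → ℝ≥0∞} {β : ℝ → ℝ} (h : IsBetaWPI μ T Ψ β)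
    (hΨ : sieveConst μ Ψ < ⊤) : ∃ K : ℝ → ℝ, IsKStarWPI μ T Ψ K := by
  -- Each `F s` solves the `β`-inequality for `ℰ / Ψ`, truncated at `0`. Taking `s ≥ 1` yields `F s
  -- v ≤ |v|`, so the supremum is finite and vanishes at `0`.
  let F : {s : ℝ // 1 ≤ s} → ℝ → ℝ := fun s v => max 0 ((v - β s) / s)
  have : Nonempty {s : ℝ // 1 ≤ s} := ⟨⟨1, le_rfl⟩⟩
  have hF0 : ∀ s v, 0 ≤ F s v := fun s v => le_max_left _ _
  have hFle : ∀ s v, F s v ≤ |v| := fun s v => by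
    have hs : (0 : ℝ) < s := zero_lt_one.trans_le s.2
    refine max_le (abs_nonneg v) ((div_le_iff₀ hs).2 ?_)
    nlinarith [h.nonneg s hs, le_abs_self v, abs_nonneg v, s.2]
  have hbdd : ∀ v, BddAbove (Set.range fun s => F s v) := fun v =>
    ⟨|v|, Set.forall_mem_range.2 fun s => hFle s v⟩
  have hconv : ConvexOn ℝ (Set.Icc 0 (sieveConst μ Ψ).toReal) fun v => ⨆ s, F s v := by
    have hF : ∀ s, ConvexOn ℝ Set.univ (F s) := fun s => by
      refine (convexOn_const 0 convex_univ).sup ⟨convex_univ, fun x _ y _ a b _ _ hab => ?_⟩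
      refine le_of_eq ?_
      simp only [smul_eq_mul]
      rw [mul_div_assoc', mul_div_assoc', ← add_div]
      congr 1
      linear_combination β s * hab
    refine ⟨convex_Icc _ _, fun x _ y _ a b ha hb hab => ciSup_le fun s => ?_⟩
    refine ((hF s).2 (Set.mem_univ x) (Set.mem_univ y) ha hb hab).trans ?_
    exact add_le_add (mul_le_mul_of_nonneg_left (le_ciSup (hbdd x) s) ha)
      (mul_le_mul_of_nonneg_left (le_ciSup (hbdd y) s) hb)
  have hz : ⨆ s, F s 0 = 0 :=
    le_antisymm (ciSup_le fun s => by simpa using hFle s 0) (Real.iSup_nonneg fun s => hF0 s 0)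
  refine ⟨fun v => ⨆ s, F s v, hΨ, fun v _ => Real.iSup_nonneg fun s => hF0 s v, hconv, ?_, hz, ?_⟩
  · refine strictMonoOn_of_convexOn ⟨le_rfl, ENNReal.toReal_nonneg⟩ (fun v hv => hv.1) hconv hz ?_
    intro v hv
    -- As `β → 0`, some `s ≥ 1` has `β s < v`, making `F s v` positive.
    obtain ⟨s, hs, hs1⟩ :=
      ((h.tendsto.eventually (gt_mem_nhds hv)).and (eventually_ge_atTop 1)).exists
    refine lt_of_lt_of_le ?_ (le_ciSup (hbdd v) ⟨s, hs1⟩)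
    exact lt_max_of_lt_right (div_pos (sub_pos.2 hs) (zero_lt_one.trans_le hs1))
  · intro f hf h1 h2
    have hp : 0 < (Ψ f).toReal := ENNReal.toReal_pos h1.ne' h2.ne
    have hE := dirichletForm_nonneg hinv f
    refine ciSup_le fun s => max_le (by positivity) ?_
    have hs : (0 : ℝ) < s := zero_lt_one.trans_le s.2
    have hsE := mul_nonneg hs.le hE
    have hβ := h.nonneg s hs
    have := h.ineq s hs f hf
    rw [← ENNReal.ofReal_toReal h2.ne, ← ENNReal.ofReal_mul hβ,
      ← ENNReal.ofReal_add hsE (by positivity),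
      ENNReal.ofReal_le_ofReal_iff (by positivity)] at this
    rw [div_le_iff₀ hs, sub_le_iff_le_add, div_le_iff₀ hp, add_mul, div_mul_eq_mul_div,
      div_mul_cancel₀ _ hp.ne']
    linarith

end WeakPoincare

theorem mainTheorem5 {E : Type*} [MeasurableSpace E] (μ : Measure E) [IsProbabilityMeasure μ]
    (T : Kernel E E) [IsMarkovKernel T] (hinv : Kernel.Invariant T μ)
    (hirr : Kernel.IsIrreducible μ T) :
    WeakPoincare.SatisfiesWPI μ T (WeakPoincare.oscSq μ) := by
  have H := fun r (hr : r > 0) => WeakPoincare.exists_mem_admissible hinv hirr hr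
  obtain ⟨β, hβ⟩ := WeakPoincare.exists_isBetaWPI hinv H
    fun s hs => ⟨1, WeakPoincare.one_mem_admissible hinv (le_of_lt hs)⟩
  exact ⟨WeakPoincare.exists_isAlphaWPI hinv H, ⟨β, hβ⟩, hβ.exists_isKStarWPI hinv
    (WeakPoincare.sieveConst_oscSq_le_one.trans_lt ENNReal.one_lt_top)⟩
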